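/- **Setting.** Let $L,n_w,n_c,R,n_{\rm spl}$ be positive integers with $n_c \mid n_w$. Let $\mathcal V=\{1,\dots,n_w\}$ (words), $\mathcal C=\{1,\dots,n_c\}$ (concepts), $\mathcal X=\mathcal V^L$ (sentences) and $\mathcal Z=\mathcal C^L$ (sequences of concepts). Let $\Phi$ be the set of all maps $\varphi:\mathcal V\to\mathcal C$ with $|\varphi^{-1}(\{c\})|=n_w/n_c$ for every $c\in\mathcal C$. A sentence is *generated by* ${\bf c}=[c_1,\dots,c_L]\in\mathcal Z$ (with respect to $\varphi$) if it is sampled uniformly at random from $\{{\bf x}\in\mathcal X:\varphi(x_\ell)=c_\ell \text{ for } 1\le \ell\le L\}$. A *task* is a tuple $\mathcal T=(\varphi;{\bf c}_1,\dots,{\bf c}_R;{\bf c}'_1,\dots,{\bf c}'_R)\in\mathfrak T:=\Phi\times\mathcal Z^{2R}$. Given a task $\mathcal T$, a training set $S=({\bf x}_{r,s})_{1\le r\le R,\,1\le s\le n_{\rm spl}}$ is drawn as follows: all sentences are independent, ${\bf x}_{r,1}$ is generated by the unfamiliar sequence ${\bf c}'_r$, and ${\bf x}_{r,2},\dots,{\bf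 x}_{r,n_{\rm spl}}$ are generated by the familiar sequence ${\bf c}_r$; the sentence ${\bf x}_{r,s}$ has label $r$. Fix a category $q\in\{1,\dots,R\}$; independently of $S$, a test sentence ${\bf x}^{\rm test}$ with label $q$ is generated by the unfamiliar sequence ${\bf c}'_q$. Let $\mathcal F$ be a real Hilbert space (the feature space) and let $\psi:\mathcal X\to\mathcal F$ be any map (the feature map). The nearest-neighbor rule *fails* if some pair $(r,s)$ maximizing $\langle\psi({\bf x}^{\rm test}),\psi({\bf x}_{r,s})\rangle_{\mathcal F}$ over all $1\le r\le R$, $1\le s\le n_{\rm spl}$ has $r\ne q$ (so a tie between different labels counts as a failure). Let $\mathrm{err}_q(\mathcal F,\psi,\mathcal T)$ be the probability of failure for the task $\mathcal T$, over the random choice of $S$ and ${\bf x}^{\rm test}$, and let $$\overline{\mathrm{err}}_q(\mathcal F,\psi,\mathfrak T)=\frac1{|\mathfrak T|}\sum_{\mathcal T\in\mathfrak T}\mathrm{err}_q(\mathcal F,\psi,\mathcal T).$$ **Theorem 1.** Let $L=9$, $n_w=150$, $n_c=5$, $R=1000$ and $n_{\rm spl}\ge 2$. Then $$\overline{\mathrm{err}}_q(\mathcal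 F,\psi,\mathfrak T)>98.4\%$$ for every category $q\in\{1,\dots,R\}$, every real Hilbert space $\mathcal F$ and every map $\psi:\mathcal X\to\mathcal F$. (Consequently the same bound holds when the test category is itself chosen at random, independently of everything else.) -/

import Mathlib

noncomputable section

namespace LongTail

/-- Sentences: sequences of `L` words of the vocabulary `Fin nw`. -/
abbrev Sentence (nw L : ℕ) : Type := Fin L → Fin nw

/-- Latent space: sequences of `L` concepts, the set of concepts being `Fin nc`. -/
abbrev ConceptSeq (nc L : ℕ) : Type := Fin L → Fin nc

/-- Equipartitions of the vocabulary: maps `φ` from words to concepts such that every concept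
contains exactly `nw / nc` words (an exact quotient, so the condition is written as a product). -/
abbrev Equipartition (nw nc : ℕ) : Type :=
  {φ : Fin nw → Fin nc // ∀ c : Fin nc, (Finset.univ.filter fun w => φ w = c).card * nc = nw}

/-- A task `(φ ; c₁, …, c_R ; c'₁, …, c'_R)`: an equipartition of the vocabulary, `R` familiar
sequences of concepts (second component), `R` unfamiliar sequences of concepts (third component). -/
abbrev Task (nw nc L R : ℕ) : Type :=
  Equipartition nw nc × (Fin R → ConceptSeq nc L) × (Fin R → ConceptSeq nc L)

/-- A training set: `S r s` is the `s`-th sentence of category `r`. The index `s = 0` is the single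
unfamiliar sentence of the category, all other indices are familiar sentences. -/
abbrev TrainingSet (nw L R nspl : ℕ) : Type := Fin R → Fin nspl → Sentence nw L

/-- The sentences whose words belong, position by position, to the concepts of the sequence `c`. -/
def sentencesOf {nw nc L : ℕ} (φ : Equipartition nw nc) (c : ConceptSeq nc L) :
    Finset (Sentence nw L) :=
  Finset.univ.filter fun x => ∀ l, φ.1 (x l) = c l

/-- Probability that a sentence randomly generated by `c`, that is, sampled uniformly at random
from `sentencesOf φ c`, is equal to `x`. -/
def genProb {nw nc L : ℕ} (φ : Equipartition nw nc) (c : ConceptSeq nc L)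
    (x : Sentence nw L) : ℝ :=
  if x ∈ sentencesOf φ c then 1 / ((sentencesOf φ c).card : ℝ) else 0

/-- The training distribution of a task: all sentences are independent, the first sentence of
category `r` is generated by `c'_r`, the other ones by `c_r`. -/
def trainProb {nw nc L R nspl : ℕ} (T : Task nw nc L R) (S : TrainingSet nw L R nspl) : ℝ :=
  ∏ r : Fin R, ∏ s : Fin nspl,
    genProb T.1 (if (s : ℕ) = 0 then T.2.2 r else T.2.1 r) (S r s)

/-- The distribution of an unfamiliar test sentence of category `q`: it is generated by `c'_q`. -/
def testProb {nw nc L R : ℕ} (T : Task nw nc L R) (q : Fin R) (x : Sentence nw L) : ℝ :=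
  genProb T.1 (T.2.2 q) x

/-- The nearest neighbor rule fails on the test sentence `x` of category `q`: some training
sentence that attains the largest inner product with `x` in feature space carries a label different
from `q`. Ties between different labels thus count as failures. -/
def NNFails {nw L R nspl : ℕ} {F : Type*} [NormedAddCommGroup F] [InnerProductSpace ℝ F]
    (ψ : Sentence nw L → F) (q : Fin R) (S : TrainingSet nw L R nspl) (x : Sentence nw L) : Prop :=
  ∃ (r : Fin R) (s : Fin nspl), r ≠ q ∧
    ∀ (r' : Fin R) (s' : Fin nspl), inner ℝ (ψ x) (ψ (S r' s')) ≤ inner ℝ (ψ x) (ψ (S r s))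

open Classical in
/-- Expected generalization error of the nearest neighbor rule on the task `T`, over the training
set and over an unfamiliar test sentence of category `q`. -/
def err (nspl : ℕ) {nw nc L R : ℕ} {F : Type*} [NormedAddCommGroup F] [InnerProductSpace ℝ F]
    (ψ : Sentence nw L → F) (q : Fin R) (T : Task nw nc L R) : ℝ :=
  ∑ S : TrainingSet nw L R nspl, trainProb T S *
    ∑ x : Sentence nw L, if NNFails ψ q S x then testProb T q x else 0

/-- Average of the expected generalization error over the collection of all tasks. -/
def avgErr (nspl nc : ℕ) {nw L R : ℕ} {F : Type*} [NormedAddCommGroup F] [InnerProductSpace ℝ F]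
    (ψ : Sentence nw L → F) (q : Fin R) : ℝ :=
  (∑ T : Task nw nc L R, err nspl ψ q T) / (Fintype.card (Task nw nc L R) : ℝ)

end LongTail

end

noncomputable section

set_option linter.constructorNameAsVariable false

/-! Put K x y = ⟨ψ x, ψ y⟩; only the order of the numbers K x y for fixed x matters. When the rule
succeeds, the closest training sentence lies in category q and is either familiar or unfamiliar
(`wins_of_not_nnFails`).

Familiar winner: the test sentence depends only on φ and c'_q, so permuting the familiar sequences
shows that every category is equally likely to own the best familiar sentence. Averaged over tasks,
this costs at most 1/R = 0.001 (`sum_eventProb_familiarWins_le`).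

Unfamiliar winner: it must beat the unfamiliar and one familiar sentence of each of the 999 other
categories. For fixed φ, averaging over their concept sequences makes these 1998 sentences
independent and uniform over all sentences. What remains is the mean of F(x, y)^1998, F being
`fractionBelow`, over φ and the pairs with φ(x_l) = φ(y_l) for all l
(`sum_eventProb_unfamiliarWins_le`). Over all pairs this mean would be at most 1/1999, since 1999
uniform sentences have at most one strict maximum.

To compare the two means, fix (x, y) and average over φ instead. Let the rank of (x, y) be that of
the graph on words with edges x_l y_l (`pairCorank`). If it is at least 7, at most 22.623 / 5^9 of
all φ are constant on the edges (`card_respecting_le`), and 5^(-9) is the overall density of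
monochromatic pairs. For each φ, pairs of rank at most 6 are at most 0.003578 of the monochromatic
ones (`card_low_pairs_le`), and there F ≤ 1 suffices. In total 0.003578 + 22.623/1999 + 0.001 <
0.016. -/

namespace LongTail


/-! ### Rank of the graph of word pairs, and a count of monochromatic tuples of low rank -/

section UnionFind

variable {V : Type*} [DecidableEq V]

/-- Union-find step: merges the classes of `p.1` and `p.2` of a representative function. -/
def mergePair (r : V → V) (p : V × V) : V → V := fun v => if r v = r p.2 then r p.1 else r v

/-- The representative function obtained by merging successively all pairs of a tuple. -/
def mergeAll : (n : ℕ) → (V → V) → (Fin n → V × V) → (V → V)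
  | 0, r, _ => r
  | n + 1, r, z => mergeAll n (mergePair r (z 0)) (fun i => z i.succ)

/-- Number of non-representatives. -/
def corank [Fintype V] (r : V → V) : ℕ := (Finset.univ.filter fun v => r v ≠ v).card

lemma mergePair_idem {r : V → V} (hr : ∀ v, r (r v) = r v) (p : V × V) (v : V) :
    mergePair r p (mergePair r p v) = mergePair r p v := by
  unfold mergePair
  by_cases h : r v = r p.2
  · by_cases h' : r p.1 = r p.2 <;> simp [h, hr, h']
  · simp [h, hr]

lemma mergePair_of_eq {r : V → V} {p : V × V} (h : r p.1 = r p.2) : mergePair r p = r := by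
  funext v
  unfold mergePair
  split_ifs with h'
  · rw [h, h']
  · rfl

/-- Merging two different classes demotes exactly one representative, `r p.2`. -/
lemma corank_mergePair_of_ne [Fintype V] {r : V → V} (hr : ∀ v, r (r v) = r v) {p : V × V}
    (h : r p.1 ≠ r p.2) : corank (mergePair r p) = corank r + 1 := by
  unfold corank
  rw [← Finset.card_insert_of_notMem (a := r p.2) (by simp [hr])]
  congr 1
  ext v
  simp only [Finset.mem_filter, Finset.mem_univ, true_and, Finset.mem_insert]
  unfold mergePair
  by_cases h1 : r v = r p.2
  · rw [if_pos h1]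
    constructor
    · intro _
      by_cases h2 : v = r p.2
      · exact Or.inl h2
      · exact Or.inr (fun h3 => h2 (h3.symm.trans h1))
    · intro _ h3
      apply h
      rw [← h1, ← h3, hr]
  · rw [if_neg h1]
    constructor
    · exact Or.inr
    · rintro (h2 | h2)
      · exact absurd (by rw [h2, hr]) h1
      · exact h2

lemma comp_mergePair {C : Type*} {φ : V → C} {r : V → V} (h : ∀ v, φ (r v) = φ v) {p : V × V}
    (hp : φ p.1 = φ p.2) (v : V) : φ (mergePair r p v) = φ v := by
  unfold mergePair
  split_ifs with h'
  · rw [h, hp, ← h p.2, ← h', h]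
  · exact h v

lemma mergeAll_idem (n : ℕ) : ∀ {r : V → V}, (∀ v, r (r v) = r v) → ∀ (z : Fin n → V × V) (v : V),
    mergeAll n r z (mergeAll n r z v) = mergeAll n r z v := by
  induction n with
  | zero => intro r hr z v; exact hr v
  | succ n ih => intro r hr z v; exact ih (mergePair_idem hr _) _ v

lemma comp_mergeAll {C : Type*} {φ : V → C} (n : ℕ) : ∀ {r : V → V}, (∀ v, φ (r v) = φ v) →
    ∀ {z : Fin n → V × V}, (∀ l, φ (z l).1 = φ (z l).2) → ∀ v, φ (mergeAll n r z v) = φ v := by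
  induction n with
  | zero => intro r hr z hz v; exact hr v
  | succ n ih => intro r hr z hz v; exact ih (comp_mergePair hr (hz 0)) (fun l => hz l.succ) v

/-- Two distinct equivalent elements are both non-representatives, or one of them represents the
other one. -/
lemma card_equivalent_pairs_le [Fintype V] (r : V → V) :
    (Finset.univ.filter fun p : V × V => r p.1 = r p.2).card
      ≤ Fintype.card V + corank r ^ 2 + corank r := by
  set K : Finset V := Finset.univ.filter fun v => r v ≠ v with hK
  -- The four pieces have sizes at most N, k² - k, k and k, where k is the corank. The total is
  -- attained when a single class of k + 1 elements is nontrivial.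
  have hsub : (Finset.univ.filter fun p : V × V => r p.1 = r p.2) ⊆
      (Finset.univ.image fun v : V => (v, v)) ∪ K.offDiag ∪ (K.image fun v => (v, r v)) ∪
        (K.image fun v => (r v, v)) := by
    rintro ⟨a, b⟩ h
    simp only [Finset.mem_filter, Finset.mem_univ, true_and] at h
    simp only [Finset.mem_union, Finset.mem_image, Finset.mem_univ, true_and, Finset.mem_offDiag,
      hK, Finset.mem_filter, Prod.mk.injEq]
    by_cases hab : a = b
    · exact Or.inl (Or.inl (Or.inl ⟨a, rfl, hab⟩))
    by_cases ha : r a = a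
    · have hb : r b ≠ b := fun hb => hab (by rw [← ha, h, hb])
      exact Or.inr ⟨b, hb, by rw [← h, ha], rfl⟩
    · by_cases hb : r b = b
      · exact Or.inl (Or.inr ⟨a, ha, rfl, by rw [h, hb]⟩)
      · exact Or.inl (Or.inl (Or.inr ⟨ha, hb, hab⟩))
  have h1 : (Finset.univ.image fun v : V => (v, v)).card ≤ Fintype.card V := Finset.card_image_le
  have h2 : (K.image fun v => (v, r v)).card ≤ K.card := Finset.card_image_le
  have h3 : (K.image fun v => (r v, v)).card ≤ K.card := Finset.card_image_le
  have h4 : K.offDiag.card + K.card = K.card ^ 2 := by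
    rw [Finset.offDiag_card, sq]
    exact Nat.sub_add_cancel (Nat.le_mul_self _)
  have h5 := Finset.card_le_card hsub
  have h6 := Finset.card_union_le ((Finset.univ.image fun v : V => (v, v)) ∪ K.offDiag ∪
    (K.image fun v => (v, r v))) (K.image fun v => (r v, v))
  have h7 := Finset.card_union_le ((Finset.univ.image fun v : V => (v, v)) ∪ K.offDiag)
    (K.image fun v => (v, r v))
  have h8 := Finset.card_union_le (Finset.univ.image fun v : V => (v, v)) K.offDiag
  have h9 : corank r = K.card := rfl
  rw [h9]
  omega

/-- Bound on the number of sequences of `n` pairs, out of `M`, along which a representative function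
of corank `k` on `N` points reaches a corank of at most `t`. -/
def lowCorankBound (N M t : ℕ) : ℕ → ℕ → ℕ
  | 0, k => if k ≤ t then 1 else 0
  | n + 1, k => min (N + k ^ 2 + k) M * lowCorankBound N M t n k +
      (M - min (N + k ^ 2 + k) M) * lowCorankBound N M t n (k + 1)

lemma convex_comb_le {M q q' a b : ℕ} (hq : q ≤ q') (hM : q' ≤ M) (hab : b ≤ a) :
    q * a + (M - q) * b ≤ q' * a + (M - q') * b := by
  obtain ⟨d, rfl⟩ := Nat.exists_eq_add_of_le hq
  obtain ⟨e, rfl⟩ := Nat.exists_eq_add_of_le hM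
  have h1 : q + d + e - q = d + e := by omega
  have h2 : q + d + e - (q + d) = e := by omega
  rw [h1, h2]
  nlinarith [Nat.mul_le_mul_left d hab]

/-- Both sides are weighted sums of total weight `M`, and by induction both compare with `M *
lowCorankBound N M t n (k + 1)`. This monotonicity is what allows overestimating the number of pairs
that leave the corank unchanged. -/
lemma lowCorankBound_succ_le (N M t n : ℕ) : ∀ k,
    lowCorankBound N M t n (k + 1) ≤ lowCorankBound N M t n k := by
  induction n with
  | zero => intro k; unfold lowCorankBound; split_ifs <;> omega
  | succ n ih =>
    intro k
    have h1 : lowCorankBound N M t (n + 1) (k + 1) ≤ M * lowCorankBound N M t n (k + 1) := by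
      have := convex_comb_le (M := M) (min_le_right (N + (k + 1) ^ 2 + (k + 1)) M) le_rfl
        (ih (k + 1))
      simpa [lowCorankBound] using this
    have h2 : M * lowCorankBound N M t n (k + 1) ≤ lowCorankBound N M t (n + 1) k := by
      have := convex_comb_le (M := M) (Nat.zero_le (min (N + k ^ 2 + k) M)) (min_le_right _ _)
        (ih k)
      simpa [lowCorankBound] using this
    exact h1.trans h2

lemma card_filter_fin_succ {β : Type*} [Fintype β] {n : ℕ} (P : (Fin (n + 1) → β) → Prop)
    [DecidablePred P] :
    (Finset.univ.filter P).card =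
      ∑ p : β, (Finset.univ.filter fun z : Fin n → β => P (Fin.cons p z)).card := by
  simp only [Finset.card_filter]
  rw [← (Fin.consEquiv fun _ => β).sum_comp, Fintype.sum_prod_type]
  rfl

/-- Condition on the first pair: among the `M` monochromatic pairs, those inside a class of `r` keep
the corank and all others raise it by one. -/
lemma card_corank_mergeAll_le [Fintype V] {C : Type*} [DecidableEq C] (φ : V → C) (t M : ℕ)
    (hM : (Finset.univ.filter fun p : V × V => φ p.1 = φ p.2).card = M) (n : ℕ) :
    ∀ {r : V → V}, (∀ v, r (r v) = r v) → (∀ v, φ (r v) = φ v) →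
    (Finset.univ.filter fun z : Fin n → V × V =>
      (∀ l, φ (z l).1 = φ (z l).2) ∧ corank (mergeAll n r z) ≤ t).card
      ≤ lowCorankBound (Fintype.card V) M t n (corank r) := by
  induction n with
  | zero =>
    intro r hr hφ
    simp only [mergeAll, lowCorankBound, IsEmpty.forall_iff, true_and]
    split_ifs with h <;> simp [h]
  | succ n ih =>
    intro r hr hφ
    rw [card_filter_fin_succ]
    set a := lowCorankBound (Fintype.card V) M t n (corank r) with ha
    set b := lowCorankBound (Fintype.card V) M t n (corank r + 1) with hb
    set E := Finset.univ.filter fun p : V × V => r p.1 = r p.2 with hE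
    set Mo := Finset.univ.filter fun p : V × V => φ p.1 = φ p.2 with hMo
    have hsub : E ⊆ Mo := by
      intro p hp
      simp only [hE, hMo, Finset.mem_filter, Finset.mem_univ, true_and] at hp ⊢
      rw [← hφ p.1, hp, hφ]
    have hterm : ∀ p : V × V, (Finset.univ.filter fun z : Fin n → V × V =>
        (∀ l, φ ((Fin.cons p z : Fin (n + 1) → V × V) l).1 =
          φ ((Fin.cons p z : Fin (n + 1) → V × V) l).2) ∧
          corank (mergeAll (n + 1) r (Fin.cons p z)) ≤ t).card ≤
        (if p ∈ E then a else 0) + if p ∈ Mo \ E then b else 0 := by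
      intro p
      by_cases hp : φ p.1 = φ p.2
      · have h1 := ih (mergePair_idem hr p) (comp_mergePair hφ hp)
        refine le_trans (Finset.card_le_card ?_) (h1.trans ?_)
        · intro z hz
          simp only [Finset.mem_filter, Finset.mem_univ, true_and] at hz ⊢
          refine ⟨fun l => by simpa using hz.1 l.succ, ?_⟩
          simpa [mergeAll] using hz.2
        · by_cases hrp : r p.1 = r p.2
          · simp [hE, hrp, mergePair_of_eq hrp, ha]
          · simp [hE, hMo, hrp, hp, corank_mergePair_of_ne hr hrp, hb]
      · have : (Finset.univ.filter fun z : Fin n → V × V =>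
            (∀ l, φ ((Fin.cons p z : Fin (n + 1) → V × V) l).1 =
            φ ((Fin.cons p z : Fin (n + 1) → V × V) l).2) ∧
            corank (mergeAll (n + 1) r (Fin.cons p z)) ≤ t) = ∅ := by
          rw [Finset.filter_eq_empty_iff]
          intro z _ h
          exact hp (by simpa using h.1 0)
        rw [this]
        simp
    refine (Finset.sum_le_sum fun p _ => hterm p).trans ?_
    rw [Finset.sum_add_distrib, Finset.sum_ite_mem, Finset.sum_ite_mem, Finset.univ_inter,
      Finset.univ_inter, Finset.sum_const, Finset.sum_const, Finset.card_sdiff_of_subset hsub, hM,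
      smul_eq_mul, smul_eq_mul]
    have hEM : E.card ≤ M := hM ▸ Finset.card_le_card hsub
    exact convex_comb_le (le_min (card_equivalent_pairs_le r) hEM) (min_le_right _ _)
      (lowCorankBound_succ_le _ _ _ _ _)

end UnionFind


/-! ### Equipartitions constant along a graph of rank at least 7 -/

lemma card_fiber_comp_perm {V C : Type*} [Fintype V] [DecidableEq C] (f : V → C)
    (σ : Equiv.Perm V) (c : C) :
    (Finset.univ.filter fun w => (f ∘ σ) w = c).card = (Finset.univ.filter fun w => f w = c).card :=
  Finset.card_equiv σ (by simp)

/-- Precomposition of equipartitions with a permutation of the vocabulary. -/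
def Equipartition.permute {nw nc : ℕ} (σ : Equiv.Perm (Fin nw)) :
    Equipartition nw nc ≃ Equipartition nw nc where
  toFun φ := ⟨φ.1 ∘ σ, fun c => (congrArg (· * nc) (card_fiber_comp_perm φ.1 σ c)).trans (φ.2 c)⟩
  invFun φ := ⟨φ.1 ∘ σ.symm,
    fun c => (congrArg (· * nc) (card_fiber_comp_perm φ.1 σ.symm c)).trans (φ.2 c)⟩
  left_inv φ := by ext; simp
  right_inv φ := by ext; simp

/-- The pointwise stabilizer of `W` is 2-transitive on the complement, so every pair outside `W` is
equally likely to be monochromatic. -/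
lemma exists_perm_of_pairs {V : Type*} [DecidableEq V] {W : Finset V} {u w u' w' : V}
    (hu : u ∉ W) (hw : w ∉ W) (hu' : u' ∉ W) (hw' : w' ∉ W) (h : u ≠ w) (h' : u' ≠ w') :
    ∃ σ : Equiv.Perm V, (∀ v ∈ W, σ v = v) ∧ σ u = u' ∧ σ w = w' := by
  have key : ∀ {a b v : V}, a ∉ W → b ∉ W → v ∈ W → Equiv.swap a b v = v := by
    intro a b v ha hb hv
    exact Equiv.swap_apply_of_ne_of_ne (fun e => ha (e ▸ hv)) (fun e => hb (e ▸ hv))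
  have hw1 : Equiv.swap u u' w ∉ W := by
    intro hmem
    have h1 := key hu hu' hmem
    rw [Equiv.swap_apply_self] at h1
    exact hw (h1 ▸ hmem)
  refine ⟨Equiv.swap (Equiv.swap u u' w) w' * Equiv.swap u u', ?_, ?_, ?_⟩
  · intro v hv
    rw [Equiv.Perm.mul_apply, key hu hu' hv, key hw1 hw' hv]
  · rw [Equiv.Perm.mul_apply, Equiv.swap_apply_left]
    refine Equiv.swap_apply_of_ne_of_ne (fun e => h ?_) h'
    apply (Equiv.swap u u').injective
    rw [Equiv.swap_apply_left, ← e]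
  · rw [Equiv.Perm.mul_apply, Equiv.swap_apply_left]

/-- The equipartitions that are constant on every pair `(a, r a)`, `a ∈ A`. -/
def compatible {nw : ℕ} (nc : ℕ) (r : Fin nw → Fin nw) (A : Finset (Fin nw)) :
    Finset (Equipartition nw nc) :=
  Finset.univ.filter fun φ => ∀ a ∈ A, φ.1 (r a) = φ.1 a

lemma permute_mem_compatible {nw nc : ℕ} {r : Fin nw → Fin nw} {A : Finset (Fin nw)}
    {σ : Equiv.Perm (Fin nw)} (hσ : ∀ v ∈ A ∪ A.image r, σ v = v) (φ : Equipartition nw nc) :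
    Equipartition.permute σ φ ∈ compatible nc r A ↔ φ ∈ compatible nc r A := by
  simp only [compatible, Finset.mem_filter, Finset.mem_univ, true_and]
  refine forall₂_congr fun a ha => ?_
  have h1 : σ a = a := hσ a (Finset.mem_union_left _ ha)
  have h2 : σ (r a) = r a := hσ _ (Finset.mem_union_right _ (Finset.mem_image_of_mem r ha))
  simp [Equipartition.permute, h1, h2]

lemma card_compatible_filter_eq {nw nc : ℕ} {r : Fin nw → Fin nw} {A : Finset (Fin nw)}
    {σ : Equiv.Perm (Fin nw)} (hσ : ∀ v ∈ A ∪ A.image r, σ v = v) (u w : Fin nw) :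
    ((compatible nc r A).filter fun φ => φ.1 (σ u) = φ.1 (σ w)).card =
      ((compatible nc r A).filter fun φ => φ.1 u = φ.1 w).card := by
  refine Finset.card_equiv (Equipartition.permute σ) fun φ => ?_
  simp only [Finset.mem_filter, permute_mem_compatible hσ]
  rfl

section Blocks

variable (φ : Equipartition 150 5) (W : Finset (Fin 150))

lemma card_block (c : Fin 5) : (Finset.univ.filter fun w => φ.1 w = c).card = 30 := by
  have := φ.2 c
  omega

lemma card_block_sdiff (c : Fin 5) :
    ((Wᶜ).filter fun w => φ.1 w = c).card + (W.filter fun w => φ.1 w = c).card = 30 := by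
  rw [← card_block φ c, ← Finset.card_union_of_disjoint]
  · congr 1
    ext w
    simp only [Finset.mem_union, Finset.mem_filter, Finset.mem_compl, Finset.mem_univ, true_and]
    tauto
  · rw [Finset.disjoint_left]
    intro w h1 h2
    simp only [Finset.mem_filter, Finset.mem_compl] at h1 h2
    exact h1.1 h2.1

lemma card_mono_offDiag_le {j : ℕ} (hj : W.card = j) :
    ((((Wᶜ).offDiag).filter fun p => φ.1 p.1 = φ.1 p.2).card : ℤ) ≤ 4350 - 59 * j + j ^ 2 := by
  have h1 : (((Wᶜ).offDiag).filter fun p => φ.1 p.1 = φ.1 p.2).card =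
      ∑ c : Fin 5, ((((Wᶜ).filter fun w => φ.1 w = c)).offDiag).card := by
    rw [← Finset.card_biUnion]
    · congr 1
      ext p
      simp only [Finset.mem_filter, Finset.mem_offDiag, Finset.mem_compl, Finset.mem_biUnion,
        Finset.mem_univ, true_and]
      constructor
      · rintro ⟨⟨h1, h2, h3⟩, h4⟩
        exact ⟨_, ⟨h1, h4⟩, ⟨h2, rfl⟩, h3⟩
      · rintro ⟨c, ⟨h1, h2⟩, ⟨h3, h4⟩, h5⟩
        exact ⟨⟨h1, h3, h5⟩, h2.trans h4.symm⟩
    · intro c _ d _ hcd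
      rw [Function.onFun, Finset.disjoint_left]
      intro p hp hq
      simp only [Finset.mem_offDiag, Finset.mem_filter] at hp hq
      exact hcd (hp.1.2.symm.trans hq.1.2)
  set m : Fin 5 → ℤ := fun c => ((W.filter fun w => φ.1 w = c).card : ℤ) with hm
  have h2 : ∀ c, (((((Wᶜ).filter fun w => φ.1 w = c)).offDiag).card : ℤ) =
      870 - 59 * m c + m c * m c := by
    intro c
    have h3 := card_block_sdiff φ W c
    have h4 : (((Wᶜ).filter fun w => φ.1 w = c).card : ℤ) = 30 - m c := by
      rw [hm]
      simp only
      omega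
    rw [Finset.offDiag_card, Nat.cast_sub (Nat.le_mul_self _), Nat.cast_mul, h4]
    ring
  have h5 : ∑ c, m c = j := by
    rw [hm, ← hj]
    have := Finset.card_eq_sum_card_fiberwise (s := W) (t := Finset.univ) (f := φ.1)
      (fun _ _ => by simp)
    simp only
    exact_mod_cast this.symm
  -- The extreme case is `W` lying inside a single block.
  have h6 : ∑ c, m c * m c ≤ (j : ℤ) ^ 2 := by
    rw [← h5, sq, Finset.sum_mul]
    refine Finset.sum_le_sum fun c _ => mul_le_mul_of_nonneg_left ?_ (by simp [hm])
    exact Finset.single_le_sum (f := m) (fun d _ => by simp [hm]) (Finset.mem_univ c)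
  rw [h1, Nat.cast_sum, Finset.sum_congr rfl fun c _ => h2 c, Finset.sum_add_distrib,
    Finset.sum_sub_distrib, ← Finset.mul_sum, h5]
  simp only [Finset.sum_const, Finset.card_univ, Fintype.card_fin]
  norm_num
  linarith

end Blocks

section Star

variable {r : Fin 150 → Fin 150} {A : Finset (Fin 150)}

lemma card_compatible_insert (v : Fin 150) :
    (compatible 5 r (insert v A)).card =
      ((compatible 5 r A).filter fun φ => φ.1 (r v) = φ.1 v).card := by
  refine congrArg Finset.card (Finset.ext fun φ => ?_)
  simp only [compatible, Finset.mem_filter, Finset.mem_univ, true_and, Finset.mem_insert,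
    forall_eq_or_imp]
  exact and_comm

/-- Adding a pair disjoint from the previous ones. -/
lemma card_compatible_insert_new {j : ℕ} (hj : (A ∪ A.image r).card = j) {v : Fin 150}
    (hv : v ∉ A ∪ A.image r) (hrv : r v ∉ A ∪ A.image r) (hne : r v ≠ v) :
    ((compatible 5 r (insert v A)).card : ℤ) * ((150 - j) * (149 - j)) ≤
      (4350 - 59 * j + j ^ 2) * (compatible 5 r A).card := by
  set W := A ∪ A.image r with hW
  -- Double counting of couples (φ, p): by symmetry each ordered pair p outside `W` contributes the
  -- same number, while each φ is constant on a bounded number of them.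
  have hsum : ∑ p ∈ (Wᶜ).offDiag,
      (((compatible 5 r A).filter fun φ => φ.1 p.1 = φ.1 p.2).card : ℤ) =
      ((150 - j) * (149 - j)) * (compatible 5 r (insert v A)).card := by
    have hconst : ∀ p ∈ (Wᶜ).offDiag,
        (((compatible 5 r A).filter fun φ => φ.1 p.1 = φ.1 p.2).card : ℤ) =
          (compatible 5 r (insert v A)).card := by
      intro p hp
      simp only [Finset.mem_offDiag, Finset.mem_compl] at hp
      obtain ⟨σ, h1, h2, h3⟩ := exists_perm_of_pairs hrv hv hp.1 hp.2.1 hne hp.2.2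
      rw [card_compatible_insert, ← h2, ← h3, card_compatible_filter_eq h1]
    rw [Finset.sum_congr rfl hconst, Finset.sum_const, nsmul_eq_mul, Finset.offDiag_card,
      Nat.cast_sub (Nat.le_mul_self _), Nat.cast_mul]
    have : ((Wᶜ).card : ℤ) = 150 - j := by
      have := Finset.card_add_card_compl W
      rw [Fintype.card_fin] at this
      omega
    rw [this]
    ring
  have hdouble : ∑ p ∈ (Wᶜ).offDiag,
      (((compatible 5 r A).filter fun φ => φ.1 p.1 = φ.1 p.2).card : ℤ) =
      ∑ φ ∈ compatible 5 r A, ((((Wᶜ).offDiag).filter fun p => φ.1 p.1 = φ.1 p.2).card : ℤ) := by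
    simp only [Finset.card_filter, Nat.cast_sum]
    exact Finset.sum_comm
  rw [mul_comm, ← hsum, hdouble]
  refine (Finset.sum_le_sum fun φ _ => card_mono_offDiag_le φ W hj).trans ?_
  rw [Finset.sum_const, nsmul_eq_mul, mul_comm]

/-- Adding a pair whose representative occurs in one of the previous pairs. -/
lemma card_compatible_insert_old {j : ℕ} (hj : (A ∪ A.image r).card = j) {v : Fin 150}
    (hv : v ∉ A ∪ A.image r) (hrv : r v ∈ A.image r) (hrvA : r v ∉ A) :
    ((compatible 5 r (insert v A)).card : ℤ) * (150 - j) ≤ 28 * (compatible 5 r A).card := by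
  set W := A ∪ A.image r with hW
  have hrvW : r v ∈ W := Finset.mem_union_right _ hrv
  have hsum : ∑ w ∈ Wᶜ, (((compatible 5 r A).filter fun φ => φ.1 (r v) = φ.1 w).card : ℤ) =
      (150 - j) * (compatible 5 r (insert v A)).card := by
    have hconst : ∀ w ∈ Wᶜ, (((compatible 5 r A).filter fun φ => φ.1 (r v) = φ.1 w).card : ℤ) =
        (compatible 5 r (insert v A)).card := by
      intro w hw
      rw [Finset.mem_compl] at hw
      have h1 : ∀ x ∈ W, Equiv.swap v w x = x := fun x hx =>
        Equiv.swap_apply_of_ne_of_ne (fun e => hv (e ▸ hx)) (fun e => hw (e ▸ hx))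
      have h2 := card_compatible_filter_eq (nc := 5) h1 (r v) v
      rw [h1 _ hrvW, Equiv.swap_apply_left] at h2
      rw [card_compatible_insert, h2]
    rw [Finset.sum_congr rfl hconst, Finset.sum_const, nsmul_eq_mul]
    have : ((Wᶜ).card : ℤ) = 150 - j := by
      have := Finset.card_add_card_compl W
      rw [Fintype.card_fin] at this
      omega
    rw [this]
  have hdouble : ∑ w ∈ Wᶜ, (((compatible 5 r A).filter fun φ => φ.1 (r v) = φ.1 w).card : ℤ) =
      ∑ φ ∈ compatible 5 r A, (((Wᶜ).filter fun w => φ.1 (r v) = φ.1 w).card : ℤ) := by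
    simp only [Finset.card_filter, Nat.cast_sum]
    exact Finset.sum_comm
  rw [mul_comm, ← hsum, hdouble]
  -- Some `a ∈ A` has `r a = r v`, so the block of `r v` already contains two words of `W`, leaving
  -- at most 28 of its 30 outside.
  have hle : ∀ φ ∈ compatible 5 r A, (((Wᶜ).filter fun w => φ.1 (r v) = φ.1 w).card : ℤ) ≤ 28 := by
    intro φ hφ
    simp only [compatible, Finset.mem_filter, Finset.mem_univ, true_and] at hφ
    obtain ⟨a, ha, hav⟩ := Finset.mem_image.1 hrv
    have h1 := card_block_sdiff φ W (φ.1 (r v))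
    have h2 : ({a, r v} : Finset (Fin 150)) ⊆ W.filter fun w => φ.1 w = φ.1 (r v) := by
      intro w hw
      rw [Finset.mem_insert, Finset.mem_singleton] at hw
      rw [Finset.mem_filter]
      rcases hw with rfl | rfl
      · exact ⟨Finset.mem_union_left _ ha, by rw [← hav, hφ _ ha]⟩
      · exact ⟨hrvW, rfl⟩
    have h3 := Finset.card_le_card h2
    rw [Finset.card_pair (fun e : a = r v => hrvA (e ▸ ha))] at h3
    have h4 : ((Wᶜ).filter fun w => φ.1 (r v) = φ.1 w) =
        (Wᶜ).filter fun w => φ.1 w = φ.1 (r v) := by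
      ext w
      simp [eq_comm]
    rw [h4]
    omega
  refine (Finset.sum_le_sum hle).trans ?_
  rw [Finset.sum_const, nsmul_eq_mul, mul_comm]

/-- Bound on the conditional probability that one more pair is monochromatic, given that `i` pairs
are. -/
def stepBound (i : ℕ) : ℚ :=
  if i < 4 then (4350 - 118 * i + 4 * i ^ 2) / ((150 - 2 * i) * (149 - 2 * i))
  else 28 / (150 - 2 * i)

lemma stepBound_nonneg {i : ℕ} (hi : i ≤ 6) : 0 ≤ stepBound i := by
  interval_cases i <;> norm_num [stepBound]

lemma le_stepBound_mul_of_old {i j X Y : ℕ} (hi : 1 ≤ i) (hi6 : i ≤ 6) (hj : j ≤ 2 * i)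
    (h : (X : ℤ) * (150 - j) ≤ 28 * Y) : (X : ℚ) ≤ stepBound i * Y := by
  have hq : (X : ℚ) * (150 - j) ≤ 28 * Y := by
    have := (Int.cast_le (R := ℚ)).2 h
    push_cast at this
    exact this
  have hY : (0 : ℚ) ≤ Y := Nat.cast_nonneg _
  have hjq : (j : ℚ) ≤ 2 * i := by exact_mod_cast hj
  have hpos : (0 : ℚ) < 150 - j := by
    have : (i : ℚ) ≤ 6 := by exact_mod_cast hi6
    linarith
  -- At `j = 2 * i`, `stepBound` is the larger of the two conditional bounds: the disjoint-pair
  -- ratio for `i < 4`, the shared-representative ratio from `i = 4` on.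
  have hb : 28 ≤ stepBound i * (150 - j) := by
    interval_cases i <;> norm_num [stepBound] <;> push_cast at hjq <;> linarith
  refine le_of_mul_le_mul_right (hq.trans ?_) hpos
  calc 28 * Y ≤ stepBound i * (150 - j) * Y := mul_le_mul_of_nonneg_right hb hY
    _ = _ := by ring

lemma le_stepBound_mul_of_new {i j X Y : ℕ} (hi6 : i ≤ 6) (hj : j ≤ 2 * i)
    (h : (X : ℤ) * ((150 - j) * (149 - j)) ≤ (4350 - 59 * j + j ^ 2) * Y) :
    (X : ℚ) ≤ stepBound i * Y := by
  have hq : (X : ℚ) * ((150 - j) * (149 - j)) ≤ (4350 - 59 * j + j ^ 2) * Y := by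
    have := (Int.cast_le (R := ℚ)).2 h
    push_cast at this
    exact this
  have hY : (0 : ℚ) ≤ Y := Nat.cast_nonneg _
  have hj0 : (0 : ℚ) ≤ j := Nat.cast_nonneg _
  have hjq : (j : ℚ) ≤ 2 * i := by exact_mod_cast hj
  have hjj : 0 ≤ (j : ℚ) * (2 * i - j) := mul_nonneg hj0 (sub_nonneg.2 hjq)
  have hi : (i : ℚ) ≤ 6 := by exact_mod_cast hi6
  have hpos : (0 : ℚ) < (150 - j) * (149 - j) := mul_pos (by linarith) (by linarith)
  have hb : 4350 - 59 * (j : ℚ) + j ^ 2 ≤ stepBound i * ((150 - j) * (149 - j)) := by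
    interval_cases i <;> norm_num [stepBound] <;> push_cast at hjq hjj <;> nlinarith
  refine le_of_mul_le_mul_right (hq.trans ?_) hpos
  calc _ ≤ stepBound i * ((150 - j) * (149 - j)) * Y := mul_le_mul_of_nonneg_right hb hY
    _ = _ := by ring

lemma card_compatible_insert_le (hr : ∀ v, r (r v) = r v) (hA : ∀ a ∈ A, r a ≠ a) {v : Fin 150}
    (hv : r v ≠ v) (hvA : v ∉ A) (hcard : A.card ≤ 6) :
    ((compatible 5 r (insert v A)).card : ℚ) ≤ stepBound A.card * (compatible 5 r A).card := by
  have hvW : v ∉ A ∪ A.image r := by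
    rw [Finset.mem_union, Finset.mem_image]
    rintro (h | ⟨a, -, rfl⟩)
    · exact hvA h
    · exact hv (hr a)
  have hrvA : r v ∉ A := fun h => hA _ h (hr v)
  obtain ⟨j, hj⟩ : ∃ j, (A ∪ A.image r).card = j := ⟨_, rfl⟩
  have hj2 : j ≤ 2 * A.card := by
    have h1 := Finset.card_union_le A (A.image r)
    have h2 : (A.image r).card ≤ A.card := Finset.card_image_le
    omega
  by_cases hrv : r v ∈ A ∪ A.image r
  · have hrv' : r v ∈ A.image r := (Finset.mem_union.1 hrv).resolve_left hrvA
    have hpos : 1 ≤ A.card := by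
      obtain ⟨a, ha, -⟩ := Finset.mem_image.1 hrv'
      exact Finset.card_pos.2 ⟨a, ha⟩
    exact le_stepBound_mul_of_old hpos hcard hj2 (card_compatible_insert_old hj hvW hrv' hrvA)
  · exact le_stepBound_mul_of_new hcard hj2 (card_compatible_insert_new hj hvW hrv hv)

/-- Chain rule: the pairs `(a, r a)` are imposed one at a time, each multiplying the proportion of
surviving equipartitions by at most `stepBound`. -/
lemma card_compatible_le (hr : ∀ v, r (r v) = r v) (hA : ∀ a ∈ A, r a ≠ a) (hcard : A.card ≤ 7) :
    ((compatible 5 r A).card : ℚ) ≤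
      (∏ i ∈ Finset.range A.card, stepBound i) * Fintype.card (Equipartition 150 5) := by
  induction A using Finset.induction_on with
  | empty =>
    rw [Finset.card_empty, Finset.prod_range_zero, one_mul]
    exact Nat.cast_le.2 (Finset.card_le_univ _)
  | insert v A hv ih =>
    rw [Finset.card_insert_of_notMem hv] at hcard ⊢
    have hA' : ∀ a ∈ A, r a ≠ a := fun a ha => hA a (Finset.mem_insert_of_mem ha)
    have h1 := card_compatible_insert_le hr hA' (hA v (Finset.mem_insert_self _ _)) hv (by omega)
    have h2 := ih hA' (by omega)
    rw [Finset.prod_range_succ]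
    calc _ ≤ _ := h1
      _ ≤ _ := mul_le_mul_of_nonneg_left h2 (stepBound_nonneg (by omega))
      _ = _ := by ring

end Star

lemma pow_mul_le_of_le_prod_stepBound {X Y : ℕ}
    (h : (X : ℚ) ≤ (∏ i ∈ Finset.range 7, stepBound i) * Y) : (5 : ℝ) ^ 9 * X ≤ 22.623 * Y := by
  have h3 : (5 : ℚ) ^ 9 * ∏ i ∈ Finset.range 7, stepBound i ≤ 22.623 := by
    norm_num [Finset.prod_range_succ, stepBound]
  have h4 : (5 : ℚ) ^ 9 * X ≤ 22.623 * Y := by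
    calc _ ≤ 5 ^ 9 * ((∏ i ∈ Finset.range 7, stepBound i) * (Y : ℚ)) :=
          mul_le_mul_of_nonneg_left h (by norm_num)
      _ = (5 ^ 9 * ∏ i ∈ Finset.range 7, stepBound i) * (Y : ℚ) := by ring
      _ ≤ _ := mul_le_mul_of_nonneg_right h3 (Nat.cast_nonneg _)
  have := (Rat.cast_le (K := ℝ)).2 h4
  push_cast at this
  exact this

/-- Few equipartitions are constant along a representative function of corank at least `7`. -/
lemma card_respecting_le {r : Fin 150 → Fin 150} (hr : ∀ v, r (r v) = r v) (h : 7 ≤ corank r) :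
    5 ^ 9 * ((Finset.univ.filter fun φ : Equipartition 150 5 => ∀ v, φ.1 (r v) = φ.1 v).card : ℝ) ≤
      22.623 * Fintype.card (Equipartition 150 5) := by
  obtain ⟨A, hA, hA7⟩ := Finset.exists_subset_card_eq h
  have h1 := card_compatible_le (A := A) hr (fun a ha => (Finset.mem_filter.1 (hA ha)).2) hA7.le
  rw [hA7] at h1
  have h2 : (Finset.univ.filter fun φ : Equipartition 150 5 => ∀ v, φ.1 (r v) = φ.1 v).card ≤
      (compatible 5 r A).card := by
    refine Finset.card_le_card fun φ hφ => ?_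
    simp only [compatible, Finset.mem_filter, Finset.mem_univ, true_and] at hφ ⊢
    exact fun a _ => hφ a
  exact pow_mul_le_of_le_prod_stepBound ((Nat.cast_le.2 h2).trans h1)


/-! ### Strict maxima of uniform samples -/

/-- Among `n + 1` independent uniform points, each one is the strict maximum with probability at
most `1 / (n + 1)`. -/
lemma sum_card_lt_pow_le {α : Type*} [Fintype α] [DecidableEq α] (g : α → ℝ) (n : ℕ) :
    (n + 1) * ∑ y, (Finset.univ.filter fun z => g z < g y).card ^ n ≤ Fintype.card α ^ (n + 1) := by
  suffices h : ∀ s : Finset α,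
      (n + 1) * ∑ y ∈ s, (s.filter fun z => g z < g y).card ^ n ≤ s.card ^ (n + 1) from h Finset.univ
  intro s
  induction s using Finset.induction_on_max_value g with
  | empty => simp
  | insert a s ha hmax ih =>
    rw [Finset.sum_insert ha, Finset.card_insert_of_notMem ha]
    -- A new element of largest value lies strictly below no other, so the old counts do not change.
    have h1 : ∀ y ∈ s, ((insert a s).filter fun z => g z < g y) = s.filter fun z => g z < g y := by
      intro y hy
      rw [Finset.filter_insert, if_neg (not_lt.2 (hmax y hy))]
    have h2 : ((insert a s).filter fun z => g z < g a).card ≤ s.card := by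
      rw [Finset.filter_insert, if_neg (lt_irrefl _)]
      exact Finset.card_filter_le _ _
    rw [Finset.sum_congr rfl fun y hy => by rw [h1 y hy], mul_add]
    have h3 := Nat.pow_le_pow_left h2 n
    have h4 : s.card ^ (n + 1) + (n + 1) * s.card ^ n ≤ (s.card + 1) ^ (n + 1) := by
      have h5 := (Commute.all s.card 1).add_pow (n + 1)
      simp only [one_pow, mul_one] at h5
      rw [h5, Finset.sum_range_succ, Finset.sum_range_succ]
      simp
      rw [add_assoc, add_comm (s.card ^ (n + 1)), mul_comm]
      exact Nat.le_add_left _ _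
    nlinarith

/-- Fraction of the sentences that are strictly less similar to `x` than `y` is. -/
def fractionBelow {nw L : ℕ} (K : Sentence nw L → Sentence nw L → ℝ) (x y : Sentence nw L) : ℝ :=
  ((Finset.univ.filter fun z => K x z < K x y).card : ℝ) / nw ^ L

section Fraction

variable {nw L : ℕ} (K : Sentence nw L → Sentence nw L → ℝ)

lemma fractionBelow_nonneg (x y : Sentence nw L) : 0 ≤ fractionBelow K x y :=
  div_nonneg (Nat.cast_nonneg _) (pow_nonneg (Nat.cast_nonneg _) _)

lemma card_sentence : Fintype.card (Sentence nw L) = nw ^ L := by simp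

lemma fractionBelow_le_one (x y : Sentence nw L) : fractionBelow K x y ≤ 1 := by
  refine div_le_one_of_le₀ ?_ (pow_nonneg (Nat.cast_nonneg _) _)
  rw [← Nat.cast_pow, ← card_sentence]
  exact Nat.cast_le.2 (Finset.card_le_univ _)

lemma sum_fractionBelow_pow_le (hnw : 0 < nw) (n : ℕ) :
    (n + 1) * ∑ x, ∑ y, fractionBelow K x y ^ n ≤ ((nw : ℝ) ^ L) ^ 2 := by
  have hN : (0 : ℝ) < (nw : ℝ) ^ L := pow_pos (Nat.cast_pos.2 hnw) _
  have h : ∀ x, (n + 1) * ∑ y, fractionBelow K x y ^ n ≤ (nw : ℝ) ^ L := by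
    intro x
    have h1 : (((n + 1) * ∑ y, (Finset.univ.filter fun z => K x z < K x y).card ^ n : ℕ) : ℝ) ≤
        ((Fintype.card (Sentence nw L) ^ (n + 1) : ℕ) : ℝ) :=
      Nat.cast_le.2 (sum_card_lt_pow_le (K x) n)
    rw [card_sentence] at h1
    push_cast at h1
    simp only [fractionBelow, div_pow]
    rw [← Finset.sum_div, ← mul_div_assoc, div_le_iff₀ (pow_pos hN n)]
    rwa [← pow_succ']
  rw [Finset.mul_sum]
  refine (Finset.sum_le_sum fun x _ => h x).trans ?_
  rw [Finset.sum_const, Finset.card_univ, card_sentence, nsmul_eq_mul, sq, Nat.cast_pow]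

end Fraction

/-! ### Powers of the similarity rank summed over monochromatic sentence pairs -/

lemma card_mono_pairs (φ : Equipartition 150 5) :
    (Finset.univ.filter fun p : Fin 150 × Fin 150 => φ.1 p.1 = φ.1 p.2).card = 4500 := by
  have : (Finset.univ.filter fun p : Fin 150 × Fin 150 => φ.1 p.1 = φ.1 p.2).card =
      ∑ a : Fin 150, (Finset.univ.filter fun b => φ.1 b = φ.1 a).card := by
    simp only [Finset.card_filter]
    rw [Fintype.sum_prod_type]
    simp only [eq_comm]
  rw [this, Finset.sum_congr rfl fun a _ => card_block φ (φ.1 a)]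
  simp

/-- Corank of the equivalence relation generated by the pairs `(x l, y l)`. -/
def pairCorank (x y : Sentence 150 9) : ℕ := corank (mergeAll 9 id fun l => (x l, y l))

lemma lowCorankBound_value : lowCorankBound 150 4500 6 9 0 * 10 ^ 6 ≤ 3578 * 4500 ^ 9 := by
  decide +kernel

lemma card_low_pairs_le (φ : Equipartition 150 5) :
    ((Finset.univ.filter fun p : Sentence 150 9 × Sentence 150 9 =>
      (∀ l, φ.1 (p.1 l) = φ.1 (p.2 l)) ∧ pairCorank p.1 p.2 ≤ 6).card : ℝ) ≤
      0.003578 * 4500 ^ 9 := by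
  have h1 := card_corank_mergeAll_le φ.1 6 4500 (card_mono_pairs φ) 9 (r := id) (fun _ => rfl)
    (fun _ => rfl)
  have h2 : corank (id : Fin 150 → Fin 150) = 0 := by simp [corank]
  rw [h2, Fintype.card_fin] at h1
  have h3 : (Finset.univ.filter fun p : Sentence 150 9 × Sentence 150 9 =>
      (∀ l, φ.1 (p.1 l) = φ.1 (p.2 l)) ∧ pairCorank p.1 p.2 ≤ 6).card =
      (Finset.univ.filter fun z : Fin 9 → Fin 150 × Fin 150 =>
      (∀ l, φ.1 (z l).1 = φ.1 (z l).2) ∧ corank (mergeAll 9 id z) ≤ 6).card := by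
    refine Finset.card_equiv (Equiv.arrowProdEquivProdArrow _ _ _).symm fun p => ?_
    simp only [Finset.mem_filter, Finset.mem_univ, true_and]
    rfl
  rw [h3]
  have h4 := (Nat.mul_le_mul_right (10 ^ 6) h1).trans lowCorankBound_value
  generalize (Finset.univ.filter fun z : Fin 9 → Fin 150 × Fin 150 =>
      (∀ l, φ.1 (z l).1 = φ.1 (z l).2) ∧ corank (mergeAll 9 id z) ≤ 6).card = X at h4 ⊢
  have h5 : ((X * 10 ^ 6 : ℕ) : ℝ) ≤ ((3578 * 4500 ^ 9 : ℕ) : ℝ) := Nat.cast_le.2 h4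
  push_cast at h5
  linarith

lemma card_mono_of_high_le {x y : Sentence 150 9} (h : ¬ pairCorank x y ≤ 6) :
    ((Finset.univ.filter fun φ : Equipartition 150 5 => ∀ l, φ.1 (x l) = φ.1 (y l)).card : ℝ) ≤
      22.623 / 5 ^ 9 * Fintype.card (Equipartition 150 5) := by
  have h1 := card_respecting_le (mergeAll_idem 9 (fun _ => rfl) fun l => (x l, y l))
    (not_le.1 h)
  have h2 : (Finset.univ.filter fun φ : Equipartition 150 5 => ∀ l, φ.1 (x l) = φ.1 (y l)).card ≤
      (Finset.univ.filter fun φ : Equipartition 150 5 =>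
        ∀ v, φ.1 (mergeAll 9 id (fun l => (x l, y l)) v) = φ.1 v).card := by
    refine Finset.card_le_card fun φ hφ => ?_
    simp only [Finset.mem_filter, Finset.mem_univ, true_and] at hφ ⊢
    exact comp_mergeAll 9 (fun _ => rfl) hφ
  rw [div_mul_eq_mul_div, le_div_iff₀' (by norm_num)]
  exact (mul_le_mul_of_nonneg_left (Nat.cast_le.2 h2) (by norm_num)).trans h1

/-- Low-rank pairs are counted for each φ with the power bounded by 1; for high-rank pairs the sum
over φ is done first. Both parts are normalized through 150^18 / 5^9 = 4500^9. -/
lemma sum_mono_fractionBelow_le (K : Sentence 150 9 → Sentence 150 9 → ℝ) (n : ℕ) :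
    ∑ φ : Equipartition 150 5, ∑ x : Sentence 150 9, ∑ y : Sentence 150 9,
      (if ∀ l, φ.1 (x l) = φ.1 (y l) then fractionBelow K x y ^ n else 0) ≤
      Fintype.card (Equipartition 150 5) * 4500 ^ 9 * (0.003578 + 22.623 / (n + 1)) := by
  have hF : ∀ x y, 0 ≤ fractionBelow K x y ^ n := fun x y => pow_nonneg (fractionBelow_nonneg K x y) n
  have hsplit : ∀ (φ : Equipartition 150 5) (x y : Sentence 150 9),
      (if ∀ l, φ.1 (x l) = φ.1 (y l) then fractionBelow K x y ^ n else 0) ≤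
      (if (∀ l, φ.1 (x l) = φ.1 (y l)) ∧ pairCorank x y ≤ 6 then 1 else 0) +
      (if pairCorank x y ≤ 6 then 0 else
        if ∀ l, φ.1 (x l) = φ.1 (y l) then 1 else 0) * fractionBelow K x y ^ n := by
    intro φ x y
    have h1 := pow_le_one₀ (n := n) (fractionBelow_nonneg K x y) (fractionBelow_le_one K x y)
    by_cases hm : ∀ l, φ.1 (x l) = φ.1 (y l)
    · by_cases hp : pairCorank x y ≤ 6
      · simp only [if_pos hm, if_pos hp, if_pos (And.intro hm hp)]
        linarith
      · simp only [if_pos hm, if_neg hp, if_neg (fun h : _ ∧ _ => hp h.2)]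
        linarith
    · simp only [if_neg hm, if_neg (fun h : (∀ l, φ.1 (x l) = φ.1 (y l)) ∧ pairCorank x y ≤ 6 =>
        hm h.1), ite_self]
      linarith
  have hlow : ∑ φ : Equipartition 150 5, ∑ x : Sentence 150 9, ∑ y : Sentence 150 9,
      (if (∀ l, φ.1 (x l) = φ.1 (y l)) ∧ pairCorank x y ≤ 6 then (1 : ℝ) else 0) ≤
      Fintype.card (Equipartition 150 5) * (0.003578 * 4500 ^ 9) := by
    rw [← nsmul_eq_mul, ← Finset.card_univ, ← Finset.sum_const]
    refine Finset.sum_le_sum fun φ _ => ?_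
    refine le_trans (le_of_eq ?_) (card_low_pairs_le φ)
    rw [Finset.card_filter, Fintype.sum_prod_type]
    push_cast
    rfl
  have hhigh : ∑ φ : Equipartition 150 5, ∑ x : Sentence 150 9, ∑ y : Sentence 150 9,
      (if pairCorank x y ≤ 6 then 0 else
        if ∀ l, φ.1 (x l) = φ.1 (y l) then 1 else 0) * fractionBelow K x y ^ n ≤
      22.623 / 5 ^ 9 * Fintype.card (Equipartition 150 5) *
        ∑ x : Sentence 150 9, ∑ y : Sentence 150 9, fractionBelow K x y ^ n := by
    rw [Finset.sum_comm, Finset.mul_sum]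
    refine Finset.sum_le_sum fun x _ => ?_
    rw [Finset.sum_comm, Finset.mul_sum]
    refine Finset.sum_le_sum fun y _ => ?_
    rw [← Finset.sum_mul]
    refine mul_le_mul_of_nonneg_right ?_ (hF x y)
    by_cases hp : pairCorank x y ≤ 6
    · simp only [if_pos hp, Finset.sum_const_zero]
      exact mul_nonneg (by norm_num) (Nat.cast_nonneg _)
    · simp only [if_neg hp]
      refine le_trans (le_of_eq ?_) (card_mono_of_high_le hp)
      rw [Finset.card_filter]
      push_cast
      rfl
  have hsum := sum_fractionBelow_pow_le K (by norm_num) n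
  rw [Nat.cast_ofNat] at hsum
  set t := ∑ x : Sentence 150 9, ∑ y : Sentence 150 9, fractionBelow K x y ^ n with ht
  have hn : (0 : ℝ) < n + 1 := Nat.cast_add_one_pos n
  have hsum' : t ≤ ((150 : ℝ) ^ 9) ^ 2 / (n + 1) := by
    rw [le_div_iff₀' hn]
    exact hsum
  refine (Finset.sum_le_sum fun φ _ => Finset.sum_le_sum fun x _ => Finset.sum_le_sum fun y _ =>
    hsplit φ x y).trans ?_
  simp only [Finset.sum_add_distrib]
  refine (add_le_add hlow (hhigh.trans (mul_le_mul_of_nonneg_left hsum'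
    (mul_nonneg (by norm_num) (Nat.cast_nonneg _))))).trans (le_of_eq ?_)
  generalize (Fintype.card (Equipartition 150 5) : ℝ) = Y
  field_simp
  ring


/-! ### Generation probabilities and factorization by independence -/

lemma card_sentencesOf {L : ℕ} (φ : Equipartition 150 5) (c : ConceptSeq 5 L) :
    (sentencesOf φ c).card = 30 ^ L := by
  have h : sentencesOf φ c =
      Fintype.piFinset fun l => Finset.univ.filter fun w => φ.1 w = c l := by
    ext x
    simp [sentencesOf]
  rw [h, Fintype.card_piFinset, Finset.prod_congr rfl fun l _ => card_block φ (c l)]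
  simp

lemma genProb_eq {L : ℕ} (φ : Equipartition 150 5) (c : ConceptSeq 5 L) (x : Sentence 150 L) :
    genProb φ c x = if c = fun l => φ.1 (x l) then 1 / (30 : ℝ) ^ L else 0 := by
  unfold genProb
  rw [card_sentencesOf]
  simp only [sentencesOf, Finset.mem_filter, Finset.mem_univ, true_and, funext_iff, eq_comm]
  push_cast
  rfl

lemma genProb_nonneg {nw nc L : ℕ} (φ : Equipartition nw nc) (c : ConceptSeq nc L)
    (x : Sentence nw L) : 0 ≤ genProb φ c x := by
  unfold genProb
  split_ifs
  · exact div_nonneg zero_le_one (Nat.cast_nonneg _)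
  · exact le_rfl

lemma sum_genProb {L : ℕ} (φ : Equipartition 150 5) (c : ConceptSeq 5 L) :
    ∑ x, genProb φ c x = 1 := by
  unfold genProb
  rw [Finset.sum_ite_mem, Finset.univ_inter, Finset.sum_const, nsmul_eq_mul, card_sentencesOf]
  push_cast
  exact mul_one_div_cancel (by positivity)

/-- Exactly one concept sequence can generate `x`, so a random one makes the generated sentence
uniform. -/
lemma sum_concept_genProb {L : ℕ} (φ : Equipartition 150 5) (x : Sentence 150 L) :
    ∑ c, genProb φ c x = 1 / (30 : ℝ) ^ L := by
  simp only [genProb_eq, Finset.sum_ite_eq', Finset.mem_univ, if_true]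

lemma sum_concept_genProb_mul {L : ℕ} (φ : Equipartition 150 5) (x y : Sentence 150 L) :
    ∑ c, genProb φ c x * genProb φ c y =
      if ∀ l, φ.1 (x l) = φ.1 (y l) then (1 / (30 : ℝ) ^ L) ^ 2 else 0 := by
  simp only [genProb_eq, ite_mul, zero_mul, Finset.sum_ite_eq', Finset.mem_univ, if_true]
  simp only [funext_iff]
  split_ifs <;> ring

section Product

lemma sum_fun_prod {ι κ : Type*} [Fintype ι] [DecidableEq ι] [Fintype κ] (f : ι → κ → ℝ) :
    ∑ g : ι → κ, ∏ i, f i (g i) = ∏ i, ∑ k, f i k := by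
  rw [Finset.prod_univ_sum, Fintype.piFinset_univ]

lemma prod_split_const {ι : Type*} [Fintype ι] [DecidableEq ι] (q : ι) (f : ι → ℝ) (a b : ℝ)
    (hq : f q = a) (hr : ∀ r, r ≠ q → f r = b) : ∏ r, f r = a * b ^ (Fintype.card ι - 1) := by
  rw [← Finset.mul_prod_erase _ _ (Finset.mem_univ q), hq,
    Finset.prod_congr rfl fun r h => hr r (Finset.ne_of_mem_erase h), Finset.prod_const,
    Finset.card_erase_of_mem (Finset.mem_univ q), Finset.card_univ]

variable {nw nc L R nspl : ℕ}

/-- The sequence of concepts that generates the `s`-th sentence of category `r`. -/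
def concepts (T : Task nw nc L R) (r : Fin R) (s : Fin nspl) : ConceptSeq nc L :=
  if (s : ℕ) = 0 then T.2.2 r else T.2.1 r

lemma sum_trainProb_mul_prod (T : Task nw nc L R) (h : Fin R → Fin nspl → Sentence nw L → ℝ) :
    ∑ S : TrainingSet nw L R nspl, trainProb T S * ∏ r, ∏ s, h r s (S r s) =
      ∏ r, ∏ s, ∑ z, genProb T.1 (concepts T r s) z * h r s z := by
  simp only [trainProb, ← Finset.prod_mul_distrib]
  rw [sum_fun_prod fun r (u : Fin nspl → Sentence nw L) =>
    ∏ s : Fin nspl, genProb T.1 (if (s : ℕ) = 0 then T.2.2 r else T.2.1 r) (u s) * h r s (u s)]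
  refine Finset.prod_congr rfl fun r _ => ?_
  exact sum_fun_prod fun s z => genProb T.1 (concepts T r s) z * h r s z

lemma trainProb_nonneg (T : Task nw nc L R) (S : TrainingSet nw L R nspl) : 0 ≤ trainProb T S :=
  Finset.prod_nonneg fun _ _ => Finset.prod_nonneg fun _ _ => genProb_nonneg _ _ _

lemma testProb_nonneg (T : Task nw nc L R) (q : Fin R) (x : Sentence nw L) : 0 ≤ testProb T q x :=
  genProb_nonneg _ _ _

lemma sum_trainProb (T : Task 150 5 L R) : ∑ S : TrainingSet 150 L R nspl, trainProb T S = 1 := by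
  have h := sum_trainProb_mul_prod (nspl := nspl) T fun _ _ _ => 1
  simpa [sum_genProb] using h

lemma sum_testProb (T : Task 150 5 L R) (q : Fin R) : ∑ x, testProb T q x = 1 := sum_genProb _ _

end Product

/-! ### Events, and the two ways in which the rule can succeed -/

section Events

open Classical in
/-- Probability of an event over the training set and the test sentence. -/
def eventProb {nw nc L R nspl : ℕ} (q : Fin R) (T : Task nw nc L R)
    (E : TrainingSet nw L R nspl → Sentence nw L → Prop) : ℝ :=
  ∑ S, trainProb T S * ∑ x, if E S x then testProb T q x else 0

variable {nw nc L R nspl : ℕ} {q : Fin R} {T : Task nw nc L R}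

lemma eventProb_mono {E E' : TrainingSet nw L R nspl → Sentence nw L → Prop}
    (h : ∀ S x, E S x → E' S x) : eventProb q T E ≤ eventProb q T E' := by
  unfold eventProb
  refine Finset.sum_le_sum fun S _ => mul_le_mul_of_nonneg_left ?_ (trainProb_nonneg T S)
  refine Finset.sum_le_sum fun x _ => ?_
  have := testProb_nonneg T q x
  by_cases h1 : E S x
  · rw [if_pos h1, if_pos (h S x h1)]
  · rw [if_neg h1]
    split_ifs <;> linarith

lemma eventProb_or_le (E E' : TrainingSet nw L R nspl → Sentence nw L → Prop) :
    eventProb q T (fun S x => E S x ∨ E' S x) ≤ eventProb q T E + eventProb q T E' := by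
  unfold eventProb
  rw [← Finset.sum_add_distrib]
  refine Finset.sum_le_sum fun S _ => ?_
  rw [← mul_add, ← Finset.sum_add_distrib]
  refine mul_le_mul_of_nonneg_left ?_ (trainProb_nonneg T S)
  refine Finset.sum_le_sum fun x _ => ?_
  have := testProb_nonneg T q x
  by_cases h1 : E S x <;> by_cases h2 : E' S x <;> simp [h1, h2, this]

lemma eventProb_true {T : Task 150 5 L R} :
    eventProb (nspl := nspl) q T (fun _ _ => True) = 1 := by
  simp only [eventProb, if_true, sum_testProb, mul_one, sum_trainProb]

lemma eventProb_not {T : Task 150 5 L R} (E : TrainingSet 150 L R nspl → Sentence 150 L → Prop) :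
    eventProb q T (fun S x => ¬ E S x) = 1 - eventProb q T E := by
  rw [eq_sub_iff_add_eq, ← eventProb_true (q := q) (T := T) (nspl := nspl)]
  unfold eventProb
  rw [← Finset.sum_add_distrib]
  refine Finset.sum_congr rfl fun S _ => ?_
  rw [← mul_add, ← Finset.sum_add_distrib]
  refine congrArg _ (Finset.sum_congr rfl fun x _ => ?_)
  by_cases h : E S x <;> simp [h]

lemma sum_eventProb_le_one {ι : Type*} [Fintype ι] {T : Task 150 5 L R}
    (E : ι → TrainingSet 150 L R nspl → Sentence 150 L → Prop)
    (h : ∀ S x i j, E i S x → E j S x → i = j) : ∑ i, eventProb q T (E i) ≤ 1 := by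
  classical
  rw [← eventProb_true (q := q) (T := T) (nspl := nspl)]
  unfold eventProb
  rw [Finset.sum_comm]
  refine Finset.sum_le_sum fun S _ => ?_
  rw [← Finset.mul_sum, Finset.sum_comm]
  refine mul_le_mul_of_nonneg_left ?_ (trainProb_nonneg T S)
  refine Finset.sum_le_sum fun x _ => ?_
  rw [if_pos trivial]
  have h0 := testProb_nonneg T q x
  by_cases hx : ∃ i, E i S x
  · obtain ⟨i, hi⟩ := hx
    rw [Finset.sum_eq_single i]
    · rw [if_pos hi]
    · intro j _ hj
      exact if_neg fun hj' => hj (h S x j i hj' hi)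
    · simp
  · push Not at hx
    simp [hx, h0]

/-- The unfamiliar training sentence of category `q` is strictly closer to the test sentence than
the first familiar and the unfamiliar training sentences of all other categories. -/
def UnfamiliarWins {n : ℕ} (K : Sentence nw L → Sentence nw L → ℝ) (q : Fin R)
    (S : TrainingSet nw L R (n + 2)) (x : Sentence nw L) : Prop :=
  ∀ r, r ≠ q → K x (S r 0) < K x (S q 0) ∧ K x (S r 1) < K x (S q 0)

/-- Some familiar training sentence of category `q` is strictly closer to the test sentence than
the familiar training sentences of all other categories. -/
def FamiliarWins (K : Sentence nw L → Sentence nw L → ℝ) (q : Fin R)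
    (S : TrainingSet nw L R nspl) (x : Sentence nw L) : Prop :=
  ∃ s : Fin nspl, (s : ℕ) ≠ 0 ∧ ∀ r, r ≠ q → ∀ s' : Fin nspl, (s' : ℕ) ≠ 0 →
    K x (S r s') < K x (S q s)

lemma wins_of_not_nnFails {n : ℕ} {F : Type*} [NormedAddCommGroup F] [InnerProductSpace ℝ F]
    {ψ : Sentence nw L → F} {S : TrainingSet nw L R (n + 2)} {x : Sentence nw L}
    (h : ¬ NNFails ψ q S x) :
    UnfamiliarWins (fun x y => inner ℝ (ψ x) (ψ y)) q S x ∨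
      FamiliarWins (fun x y => inner ℝ (ψ x) (ψ y)) q S x := by
  obtain ⟨⟨r, s⟩, -, hmax⟩ := Finset.exists_max_image (Finset.univ : Finset (Fin R × Fin (n + 2)))
    (fun p => inner ℝ (ψ x) (ψ (S p.1 p.2))) ⟨(q, 0), Finset.mem_univ _⟩
  have hmax' : ∀ r' s', inner ℝ (ψ x) (ψ (S r' s')) ≤ inner ℝ (ψ x) (ψ (S r s)) :=
    fun r' s' => hmax (r', s') (Finset.mem_univ _)
  have hr : r = q := by
    by_contra hr
    exact h ⟨r, s, hr, hmax'⟩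
  subst hr
  have hlt : ∀ r', r' ≠ r → ∀ s', inner ℝ (ψ x) (ψ (S r' s')) < inner ℝ (ψ x) (ψ (S r s)) := by
    intro r' hr' s'
    -- A tie with another label would itself be a failure, hence strictness.
    refine lt_of_le_of_ne (hmax' r' s') fun e => h ⟨r', s', hr', fun r₂ s₂ => ?_⟩
    rw [e]
    exact hmax' r₂ s₂
  by_cases hs : s = 0
  · subst hs
    exact Or.inl fun r' hr' => ⟨hlt r' hr' 0, hlt r' hr' 1⟩
  · exact Or.inr ⟨s, fun e => hs (Fin.ext e), fun r' hr' s' _ => hlt r' hr' s'⟩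

end Events

/-! ### Exchangeability of the familiar sequences -/

section Symmetry

variable {nw nc L R nspl : ℕ}

/-- Permutes the familiar sequences of concepts of a task. -/
def permuteFamiliar (σ : Equiv.Perm (Fin R)) : Task nw nc L R ≃ Task nw nc L R :=
  (Equiv.refl _).prodCongr ((σ.arrowCongr (Equiv.refl _)).symm.prodCongr (Equiv.refl _))

/-- Permutes the familiar sentences of a training set. -/
def permuteFamiliarSentences (σ : Equiv.Perm (Fin R)) :
    TrainingSet nw L R nspl ≃ TrainingSet nw L R nspl where
  toFun S r s := if (s : ℕ) = 0 then S r s else S (σ r) s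
  invFun S r s := if (s : ℕ) = 0 then S r s else S (σ.symm r) s
  left_inv S := by
    funext r s
    by_cases h : (s : ℕ) = 0 <;> simp [h]
  right_inv S := by
    funext r s
    by_cases h : (s : ℕ) = 0 <;> simp [h]

lemma trainProb_permute (σ : Equiv.Perm (Fin R)) (T : Task nw nc L R)
    (S : TrainingSet nw L R nspl) :
    trainProb (permuteFamiliar σ T) (permuteFamiliarSentences σ S) = trainProb T S := by
  unfold trainProb
  rw [Finset.prod_comm, Finset.prod_comm (s := Finset.univ (α := Fin R))]
  refine Finset.prod_congr rfl fun s _ => ?_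
  by_cases h : (s : ℕ) = 0
  · simp [h, permuteFamiliar, permuteFamiliarSentences]
  · rw [← Equiv.prod_comp σ fun r => genProb T.1 (if (s : ℕ) = 0 then T.2.2 r else T.2.1 r) (S r s)]
    simp [h, permuteFamiliar, permuteFamiliarSentences]

lemma familiarWins_permute (K : Sentence nw L → Sentence nw L → ℝ) (σ : Equiv.Perm (Fin R))
    (q : Fin R) (S : TrainingSet nw L R nspl) (x : Sentence nw L) :
    FamiliarWins K q (permuteFamiliarSentences σ S) x ↔ FamiliarWins K (σ q) S x := by
  unfold FamiliarWins
  refine exists_congr fun s => and_congr_right fun hs => ?_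
  rw [← σ.forall_congr_right (q := fun r => r ≠ σ q → ∀ s' : Fin nspl, (s' : ℕ) ≠ 0 →
    K x (S r s') < K x (S (σ q) s))]
  refine forall_congr' fun r => imp_congr (by simp) (forall₂_congr fun s' hs' => ?_)
  simp [permuteFamiliarSentences, hs, hs']

/-- The test category `q` stays fixed while the winning category moves: the test law involves only φ
and the unfamiliar sequences, which `permuteFamiliar` leaves alone. -/
lemma sum_eventProb_familiarWins_perm (K : Sentence nw L → Sentence nw L → ℝ)
    (σ : Equiv.Perm (Fin R)) (q q' : Fin R) :
    ∑ T : Task nw nc L R, eventProb (nspl := nspl) q T (FamiliarWins K (σ q')) =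
      ∑ T : Task nw nc L R, eventProb (nspl := nspl) q T (FamiliarWins K q') := by
  rw [← (permuteFamiliar σ).sum_comp fun T => eventProb (nspl := nspl) q T (FamiliarWins K q')]
  refine Finset.sum_congr rfl fun T _ => ?_
  unfold eventProb
  rw [← (permuteFamiliarSentences σ).sum_comp fun S => trainProb (permuteFamiliar σ T) S * _]
  refine Finset.sum_congr rfl fun S _ => ?_
  rw [trainProb_permute]
  refine congrArg _ (Finset.sum_congr rfl fun x _ => ?_)
  classical exact if_congr (familiarWins_permute K σ q' S x).symm rfl rfl

/-- By symmetry between categories, a familiar sentence of category `q` is the closest one among the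
familiar sentences with probability at most `1 / R`. -/
lemma sum_eventProb_familiarWins_le (K : Sentence 150 L → Sentence 150 L → ℝ) (q : Fin R) :
    R * ∑ T : Task 150 5 L R, eventProb (nspl := nspl) q T (FamiliarWins K q) ≤
      Fintype.card (Task 150 5 L R) := by
  have h1 : ∀ q' : Fin R,
      ∑ T : Task 150 5 L R, eventProb (nspl := nspl) q T (FamiliarWins K q') =
      ∑ T : Task 150 5 L R, eventProb (nspl := nspl) q T (FamiliarWins K q) := by
    intro q'
    rw [← sum_eventProb_familiarWins_perm K (Equiv.swap q q') q q, Equiv.swap_apply_left]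
  have h2 : R * ∑ T : Task 150 5 L R, eventProb (nspl := nspl) q T (FamiliarWins K q) =
      ∑ q' : Fin R, ∑ T : Task 150 5 L R, eventProb (nspl := nspl) q T (FamiliarWins K q') := by
    rw [Finset.sum_congr rfl fun q' _ => h1 q', Finset.sum_const, Finset.card_univ,
      Fintype.card_fin, nsmul_eq_mul]
  rw [h2, Finset.sum_comm]
  have h3 : ∀ T : Task 150 5 L R,
      ∑ q' : Fin R, eventProb (nspl := nspl) q T (FamiliarWins K q') ≤ 1 := by
    intro T
    refine sum_eventProb_le_one _ fun S x i j ⟨s, hs, hi⟩ ⟨s', hs', hj⟩ => ?_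
    by_contra hij
    -- Two categories cannot both win, since each would strictly beat the other.
    exact lt_asymm (hi j (Ne.symm hij) s' hs') (hj i hij s hs)
  refine (Finset.sum_le_sum fun T _ => h3 T).trans (le_of_eq ?_)
  rw [Finset.sum_const, Finset.card_univ, nsmul_eq_mul, mul_one]

end Symmetry


/-! ### Averaging the unfamiliar win over concept sequences -/

section Unfamiliar

variable {L R n : ℕ} (K : Sentence 150 L → Sentence 150 L → ℝ) (q : Fin R) (x y : Sentence 150 L)

/-- Indicator of the constraints that the sentences of a training set satisfy when the unfamiliar
sentence of category `q` is `y` and wins on the test sentence `x`. -/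
def winIndicator (r : Fin R) (s : Fin (n + 2)) (z : Sentence 150 L) : ℝ :=
  if r = q then (if s = 0 then (if z = y then 1 else 0) else 1)
  else if s = 0 ∨ s = 1 then (if K x z < K x y then 1 else 0) else 1

lemma winIndicator_nonneg (r : Fin R) (s : Fin (n + 2)) (z : Sentence 150 L) :
    0 ≤ winIndicator K q x y r s z := by
  unfold winIndicator
  split_ifs <;> norm_num

open Classical in
lemma indicator_unfamiliarWins_le (S : TrainingSet 150 L R (n + 2)) :
    (if UnfamiliarWins K q S x then (1 : ℝ) else 0) ≤
      ∑ y, ∏ r, ∏ s, winIndicator K q x y r s (S r s) := by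
  have h0 : ∀ y, 0 ≤ ∏ r, ∏ s, winIndicator K q x y r s (S r s) := fun y =>
    Finset.prod_nonneg fun r _ => Finset.prod_nonneg fun s _ => winIndicator_nonneg K q x y r s _
  split_ifs with h
  · refine le_trans (le_of_eq ?_) (Finset.single_le_sum (fun y _ => h0 y) (Finset.mem_univ (S q 0)))
    refine (Finset.prod_eq_one fun r _ => Finset.prod_eq_one fun s _ => ?_).symm
    unfold winIndicator
    by_cases hr : r = q
    · subst hr
      by_cases hs : s = 0
      · subst hs
        simp
      · simp [hs]
    · rw [if_neg hr]
      by_cases hs : s = 0 ∨ s = 1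
      · rw [if_pos hs, if_pos]
        rcases hs with rfl | rfl
        · exact (h r hr).1
        · exact (h r hr).2
      · rw [if_neg hs]
  · exact Finset.sum_nonneg fun y _ => h0 y

/-- Probability that a sentence generated by `c` is less similar to `x` than `y`. -/
def belowProb (φ : Equipartition 150 5) (c : ConceptSeq 5 L) : ℝ :=
  ∑ z, genProb φ c z * if K x z < K x y then 1 else 0

lemma sum_belowProb (φ : Equipartition 150 5) :
    ∑ c, belowProb K x y φ c = 5 ^ L * fractionBelow K x y := by
  unfold belowProb
  rw [Finset.sum_comm]
  simp only [← Finset.sum_mul, sum_concept_genProb]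
  rw [← Finset.mul_sum, Finset.sum_boole, fractionBelow]
  have h : (150 : ℝ) ^ L = 30 ^ L * 5 ^ L := by
    rw [← mul_pow]
    norm_num
  rw [Nat.cast_ofNat, h]
  field_simp

/-- The factor of category `r` that depends on its unfamiliar sequence of concepts. -/
def unfamiliarFactor (φ : Equipartition 150 5) (r : Fin R) (c : ConceptSeq 5 L) : ℝ :=
  if r = q then genProb φ c y else belowProb K x y φ c

/-- The factor of category `r` that depends on its familiar sequence of concepts. -/
def familiarFactor (φ : Equipartition 150 5) (r : Fin R) (c : ConceptSeq 5 L) : ℝ :=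
  if r = q then 1 else belowProb K x y φ c

/-- Only sentences 0 and 1 are constrained; the remaining familiar ones integrate to 1. One familiar
sentence per category is kept because those sharing `c_r` are not independent after averaging over
it. -/
lemma prod_sum_winIndicator (T : Task 150 5 L R) :
    ∏ r, ∏ s : Fin (n + 2), ∑ z, genProb T.1 (concepts T r s) z * winIndicator K q x y r s z =
      ∏ r, unfamiliarFactor K q x y T.1 r (T.2.2 r) * familiarFactor K q x y T.1 r (T.2.1 r) := by
  refine Finset.prod_congr rfl fun r _ => ?_
  rw [Fin.prod_univ_succ, Fin.prod_univ_succ, ← mul_assoc]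
  have h2 : ∏ i : Fin n, ∑ z, genProb T.1 (concepts T r i.succ.succ) z *
      winIndicator K q x y r i.succ.succ z = 1 := by
    refine Finset.prod_eq_one fun i _ => ?_
    have hs0 : i.succ.succ ≠ 0 := Fin.succ_ne_zero _
    have hs1 : i.succ.succ ≠ 1 := fun h => Fin.succ_ne_zero i (Fin.succ_injective _ h)
    have : ∀ z, winIndicator K q x y r i.succ.succ z = 1 := by
      intro z
      simp [winIndicator, hs0, hs1]
    simp only [this, mul_one, sum_genProb]
  rw [h2, mul_one]
  have hc0 : concepts T r (0 : Fin (n + 2)) = T.2.2 r := by simp [concepts]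
  have hc1 : concepts T r (Fin.succ 0 : Fin (n + 2)) = T.2.1 r := by simp [concepts]
  rw [hc0, hc1]
  by_cases hr : r = q
  · simp [winIndicator, unfamiliarFactor, familiarFactor, hr, sum_genProb]
  · simp [winIndicator, unfamiliarFactor, familiarFactor, belowProb, hr]

lemma eventProb_unfamiliarWins_le (T : Task 150 5 L R) :
    eventProb (nspl := n + 2) q T (UnfamiliarWins K q) ≤ ∑ x, ∑ y, genProb T.1 (T.2.2 q) x *
      ∏ r, unfamiliarFactor K q x y T.1 r (T.2.2 r) * familiarFactor K q x y T.1 r (T.2.1 r) := by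
  classical
  have h1 : eventProb (nspl := n + 2) q T (UnfamiliarWins K q) ≤
      ∑ S : TrainingSet 150 L R (n + 2), trainProb T S *
        ∑ x, genProb T.1 (T.2.2 q) x * ∑ y, ∏ r, ∏ s, winIndicator K q x y r s (S r s) := by
    unfold eventProb
    refine Finset.sum_le_sum fun S _ => mul_le_mul_of_nonneg_left ?_ (trainProb_nonneg T S)
    refine Finset.sum_le_sum fun x _ => ?_
    refine le_trans (le_of_eq ?_) (mul_le_mul_of_nonneg_left (indicator_unfamiliarWins_le K q x S)
      (genProb_nonneg T.1 (T.2.2 q) x))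
    rw [mul_ite, mul_one, mul_zero]
    rfl
  refine h1.trans (le_of_eq ?_)
  simp only [Finset.mul_sum]
  rw [Finset.sum_comm]
  refine Finset.sum_congr rfl fun x _ => ?_
  rw [Finset.sum_comm]
  refine Finset.sum_congr rfl fun y _ => ?_
  rw [← prod_sum_winIndicator (n := n), ← sum_trainProb_mul_prod, Finset.mul_sum]
  refine Finset.sum_congr rfl fun S _ => ?_
  ring

/-- The sums over sequences factor by category. The sequence c'_q generates both `x` and `y`, whence
the monochromaticity condition; c_q is free and gives 5^L; all other sequences give 5^L *
`fractionBelow`. -/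
lemma sum_task_prod (φ : Equipartition 150 5) :
    ∑ c : Fin R → ConceptSeq 5 L, ∑ c' : Fin R → ConceptSeq 5 L, genProb φ (c' q) x *
      ∏ r, unfamiliarFactor K q x y φ r (c' r) * familiarFactor K q x y φ r (c r) =
    (if ∀ l, φ.1 (x l) = φ.1 (y l) then (1 / (30 : ℝ) ^ L) ^ 2 else 0) *
      (5 ^ L * fractionBelow K x y) ^ (R - 1) * (5 ^ L * (5 ^ L * fractionBelow K x y) ^ (R - 1)) := by
  set a : Fin R → ConceptSeq 5 L → ℝ := fun r c =>
    (if r = q then genProb φ c x else 1) * unfamiliarFactor K q x y φ r c with ha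
  have h1 : ∀ c c' : Fin R → ConceptSeq 5 L, genProb φ (c' q) x *
      ∏ r, unfamiliarFactor K q x y φ r (c' r) * familiarFactor K q x y φ r (c r) =
      (∏ r, a r (c' r)) * ∏ r, familiarFactor K q x y φ r (c r) := by
    intro c c'
    rw [Finset.prod_mul_distrib, ha]
    simp only
    rw [Finset.prod_mul_distrib, Finset.prod_ite_eq' Finset.univ q fun r => genProb φ (c' r) x,
      if_pos (Finset.mem_univ q), mul_assoc]
  simp only [h1, ← Finset.sum_mul, ← Finset.mul_sum]
  rw [sum_fun_prod, sum_fun_prod]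
  congr 1
  · rw [prod_split_const q _ _ (5 ^ L * fractionBelow K x y) rfl, Fintype.card_fin]
    · congr 1
      simp only [ha, if_true, unfamiliarFactor]
      exact sum_concept_genProb_mul φ x y
    · intro r hr
      simp only [ha, if_neg hr, unfamiliarFactor, one_mul]
      exact sum_belowProb K x y φ
  · rw [prod_split_const q _ (5 ^ L) (5 ^ L * fractionBelow K x y), Fintype.card_fin]
    · simp [familiarFactor]
    · intro r hr
      simp only [if_neg hr, familiarFactor]
      exact sum_belowProb K x y φ

lemma card_task (hR : 0 < R) : (Fintype.card (Task 150 5 L R) : ℝ) =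
    Fintype.card (Equipartition 150 5) * ((5 ^ L) * (5 ^ L) ^ (R - 1)) ^ 2 := by
  have h : Fintype.card (Fin R → ConceptSeq 5 L) = (5 ^ L) * (5 ^ L) ^ (R - 1) := by
    rw [Fintype.card_fun, Fintype.card_fun, Fintype.card_fin, Fintype.card_fin, Fintype.card_fin,
      ← pow_succ', Nat.sub_add_cancel hR]
  rw [Fintype.card_prod, Fintype.card_prod, h]
  push_cast
  ring

/-- Average probability, in terms of the similarity ranks, that the unfamiliar sentence wins. -/
lemma sum_eventProb_unfamiliarWins_le (hR : 0 < R) :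
    Fintype.card (Equipartition 150 5) *
      ∑ T : Task 150 5 L R, eventProb (nspl := n + 2) q T (UnfamiliarWins K q) ≤
    Fintype.card (Task 150 5 L R) * (1 / (4500 : ℝ) ^ L) *
      ∑ φ : Equipartition 150 5, ∑ x : Sentence 150 L, ∑ y : Sentence 150 L,
        if ∀ l, φ.1 (x l) = φ.1 (y l) then fractionBelow K x y ^ (2 * (R - 1)) else 0 := by
  have h1 : ∑ T : Task 150 5 L R, eventProb (nspl := n + 2) q T (UnfamiliarWins K q) ≤
      ∑ φ : Equipartition 150 5, ∑ x : Sentence 150 L, ∑ y : Sentence 150 L,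
        (if ∀ l, φ.1 (x l) = φ.1 (y l) then (1 / (30 : ℝ) ^ L) ^ 2 else 0) *
        (5 ^ L * fractionBelow K x y) ^ (R - 1) *
        (5 ^ L * (5 ^ L * fractionBelow K x y) ^ (R - 1)) := by
    refine (Finset.sum_le_sum fun T _ => eventProb_unfamiliarWins_le K q T).trans (le_of_eq ?_)
    rw [Fintype.sum_prod_type]
    refine Finset.sum_congr rfl fun φ _ => ?_
    rw [Finset.sum_comm]
    refine Finset.sum_congr rfl fun x _ => ?_
    rw [Finset.sum_comm]
    refine Finset.sum_congr rfl fun y _ => ?_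
    rw [Fintype.sum_prod_type]
    exact sum_task_prod K q x y φ
  have h0 : (0 : ℝ) ≤ Fintype.card (Equipartition 150 5) := Nat.cast_nonneg _
  rw [card_task hR]
  generalize (Fintype.card (Equipartition 150 5) : ℝ) = Y at h0 ⊢
  refine (mul_le_mul_of_nonneg_left h1 h0).trans (le_of_eq ?_)
  rw [mul_assoc, mul_assoc]
  refine congrArg (Y * ·) ?_
  simp only [Finset.mul_sum]
  refine Finset.sum_congr rfl fun φ _ => Finset.sum_congr rfl fun x _ =>
    Finset.sum_congr rfl fun y _ => ?_
  have h : (4500 : ℝ) ^ L = (30 ^ L) ^ 2 * 5 ^ L := by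
    rw [← pow_mul, mul_comm L 2, pow_mul, ← mul_pow]
    norm_num
  rw [h]
  split_ifs
  · rw [mul_pow, pow_mul' _ 2]
    field_simp
  · simp

end Unfamiliar

/-! ### Numerical conclusion -/

lemma nonempty_equipartition : Nonempty (Equipartition 150 5) :=
  ⟨⟨fun w => ⟨w % 5, Nat.mod_lt _ (by norm_num)⟩, by decide +kernel⟩⟩

lemma err_eq (nspl : ℕ) {L R : ℕ} {F : Type*} [NormedAddCommGroup F] [InnerProductSpace ℝ F]
    (ψ : Sentence 150 L → F) (q : Fin R) (T : Task 150 5 L R) :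
    err nspl ψ q T = 1 - eventProb (nspl := nspl) q T (fun S x => ¬ NNFails ψ q S x) := by
  rw [eventProb_not, sub_sub_cancel]
  rfl

lemma sum_eventProb_not_nnFails_le {n L R : ℕ} {F : Type*} [NormedAddCommGroup F]
    [InnerProductSpace ℝ F] (ψ : Sentence 150 L → F) (q : Fin R) :
    ∑ T : Task 150 5 L R, eventProb (nspl := n + 2) q T (fun S x => ¬ NNFails ψ q S x) ≤
      ∑ T : Task 150 5 L R, eventProb (nspl := n + 2) q T
        (UnfamiliarWins (fun x y => inner ℝ (ψ x) (ψ y)) q) +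
      ∑ T : Task 150 5 L R, eventProb (nspl := n + 2) q T
        (FamiliarWins (fun x y => inner ℝ (ψ x) (ψ y)) q) := by
  rw [← Finset.sum_add_distrib]
  refine Finset.sum_le_sum fun T _ => ?_
  exact (eventProb_mono fun S x h => wins_of_not_nnFails h).trans (eventProb_or_le _ _)

lemma success_bound {N Φ A B S : ℝ} (hΦ : 0 < Φ) (hN : 0 < N)
    (hA : Φ * A ≤ N * (1 / 4500 ^ 9) * S)
    (hS : S ≤ Φ * 4500 ^ 9 * (0.003578 + 22.623 / (1998 + 1))) (hB : 1000 * B ≤ N) :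
    A + B < 16 / 1000 * N := by
  have h1 : Φ * A ≤ Φ * (N * (0.003578 + 22.623 / (1998 + 1))) := by
    calc Φ * A ≤ N * (1 / 4500 ^ 9) * S := hA
      _ ≤ N * (1 / 4500 ^ 9) * (Φ * 4500 ^ 9 * (0.003578 + 22.623 / (1998 + 1))) :=
        mul_le_mul_of_nonneg_left hS (by positivity)
      _ = _ := by ring
  have h2 := le_of_mul_le_mul_left h1 hΦ
  norm_num at h2
  linarith

end LongTail

end

theorem theorem1 (nspl : ℕ) (hnspl : 2 ≤ nspl)
    {F : Type*} [NormedAddCommGroup F] [InnerProductSpace ℝ F] [CompleteSpace F]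
    (ψ : LongTail.Sentence 150 9 → F) (q : Fin 1000) :
    (984 / 1000 : ℝ) < LongTail.avgErr nspl 5 ψ q := by
  obtain ⟨n, rfl⟩ := Nat.exists_eq_add_of_le' hnspl
  have hΦ : (0 : ℝ) < Fintype.card (LongTail.Equipartition 150 5) := by
    have := LongTail.nonempty_equipartition
    exact Nat.cast_pos.2 Fintype.card_pos
  have hN : (0 : ℝ) < Fintype.card (LongTail.Task 150 5 9 1000) := by
    rw [LongTail.card_task (Nat.succ_pos 999)]
    exact mul_pos hΦ (pow_pos (mul_pos (pow_pos (by norm_num) _)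
      (pow_pos (pow_pos (by norm_num) _) _)) _)
  have hA := LongTail.sum_eventProb_unfamiliarWins_le (n := n)
    (fun x y => inner ℝ (ψ x) (ψ y)) q (Nat.succ_pos 999)
  have hS := LongTail.sum_mono_fractionBelow_le (fun x y => inner ℝ (ψ x) (ψ y)) (2 * (1000 - 1))
  have hB := LongTail.sum_eventProb_familiarWins_le (nspl := n + 2)
    (fun x y => inner ℝ (ψ x) (ψ y)) q
  have hcast : ((2 * (1000 - 1) : ℕ) : ℝ) = 1998 := by norm_num
  rw [hcast] at hS
  rw [Nat.cast_ofNat] at hB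
  have h := (LongTail.sum_eventProb_not_nnFails_le (n := n) ψ q).trans_lt
    (LongTail.success_bound hΦ hN hA hS hB)
  unfold LongTail.avgErr
  rw [lt_div_iff₀ hN, Finset.sum_congr rfl fun T _ => LongTail.err_eq (n + 2) ψ q T,
    Finset.sum_sub_distrib, Finset.sum_const, Finset.card_univ, nsmul_eq_mul, mul_one]
  linarith
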